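/- Let $X$ and $Y$ be finite-dimensional locally finite simplicial complexes (each identified with its geometric realisation), each with its standard metric $d$: the path metric that restricts on every simplex to the Euclidean metric of the standard embedding $\Delta^n\subset\mathbb{R}^{n+1}$, with $d=\infty$ between different path components. A *control map* on a space $A$ is a map $p:A\to Y$. A map $f:(A,p)\to(B,q)$ of spaces with control maps $p:A\to Y$, $q:B\to Y$ is *$\epsilon$-controlled* if $d(p(a),q(f(a)))<\epsilon$ for all $a\in A$, and *$Y$-triangular* if $q(f(p^{-1}(\mathring\sigma)))\subset\sigma$ for every closed simplex $\sigma$ of $Y$ with interior $\mathring\sigma$; for a homotopy $A\times[0,1]\to B$ the control map on $A\times[0,1]$ is $(a,t)\mapsto p(a)$. A continuous map $f:(A,p)\to (B,q)$ with $p=q\circ f$ is an *$\epsilon$-controlled homotopy equivalence* if it has an $\epsilon$-controlled homotopy inverse $g$ and $\epsilon$-controlled homotopies $g\circ f\simeq\mathrm{id}_A$, $f\circ g\simeq\mathrm{id}_B$. A continuous map $f:(A,p)\to(B,q)$ is a *$Y$-triangular homotopy equivalence* if there are a homotopy inverse $g$ and homotopies $f\circ g\simeq \mathrm{id}_B$,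 $g\circ f\simeq\mathrm{id}_A$ such that $f$, $g$ and both homotopies are $Y$-triangular. Then there exists $\epsilon=\epsilon(X,Y)>0$ such that every simplicial map $f:X\to Y$ for which $f:(X,f)\to(Y,\mathrm{id}_Y)$ is an $\epsilon$-controlled homotopy equivalence is homotopic to a map $f':X\to Y$ which is a $Y$-triangular homotopy equivalence, both as a map $(X,f)\to(Y,\mathrm{id}_Y)$ and as a map $(X,f')\to(Y,\mathrm{id}_Y)$. -/

import Mathlib

open scoped unitInterval

noncomputable section

/-- Each vertex lies in only finitely many simplices. -/
def LocallyFiniteComplex {ι : Type*} (K : AbstractSimplicialComplex ι) : Prop :=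
  ∀ v : ι, {s : Finset ι | s ∈ K.faces ∧ v ∈ s}.Finite

/-- The dimensions of the simplices are bounded (a simplex with `n + 1` vertices has
dimension `n`). -/
def FiniteDimensionalComplex {ι : Type*} (K : AbstractSimplicialComplex ι) : Prop :=
  ∃ n : ℕ, ∀ s ∈ K.faces, s.card ≤ n + 1

/-- The geometric realisation of a simplicial complex, in barycentric coordinates: finitely
supported non-negative functions on the vertices, of total mass one, whose support is a simplex. -/
@[ext]
structure Realization {ι : Type*} (K : AbstractSimplicialComplex ι) where
  coord : ι →₀ ℝ
  nonneg : ∀ v, 0 ≤ coord v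
  sum_eq_one : (coord.sum fun _ t => t) = 1
  support_mem : coord.support ∈ K.faces

/-- The closed simplex of the realisation spanned by the set `s` of vertices. -/
def closedSimplex {ι : Type*} (K : AbstractSimplicialComplex ι) (s : Finset ι) :
    Set (Realization K) :=
  {x | x.coord.support ⊆ s}

/-- The open simplex (the closed simplex minus its boundary) spanned by `s`. -/
def openSimplex {ι : Type*} (K : AbstractSimplicialComplex ι) (s : Finset ι) :
    Set (Realization K) :=
  {x | x.coord.support = s}

/-- The Euclidean distance of barycentric coordinates. For two points of a closed simplex `s` it is
their distance in the standard embedding of `s` in `ℝ ^ (dim s + 1)`. -/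
def euclideanGap {ι : Type*} {K : AbstractSimplicialComplex ι} (x y : Realization K) : ℝ :=
  Real.sqrt ((x.coord - y.coord).sum fun _ t => t ^ 2)

/-- `c 0, …, c n` are the successive break points of a broken line from `x` to `y`, each of whose
`n` straight segments lies in a closed simplex. -/
def IsBrokenLine {ι : Type*} {K : AbstractSimplicialComplex ι} (x y : Realization K) (n : ℕ)
    (c : ℕ → Realization K) : Prop :=
  c 0 = x ∧ c n = y ∧
    ∀ i < n, ∃ s ∈ K.faces, c i ∈ closedSimplex K s ∧ c (i + 1) ∈ closedSimplex K s

/-- The length of the broken line with break points `c 0, …, c n`. -/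
def brokenLineLength {ι : Type*} {K : AbstractSimplicialComplex ι} (n : ℕ)
    (c : ℕ → Realization K) : ENNReal :=
  ∑ i ∈ Finset.range n, ENNReal.ofReal (euclideanGap (c i) (c (i + 1)))

/-- The standard path metric: the infimum of the lengths of the broken lines between two points,
which is infinite if there are none, that is, between different path components. -/
instance Realization.instEDist {ι : Type*} {K : AbstractSimplicialComplex ι} :
    EDist (Realization K) where
  edist x y := ⨅ (n : ℕ) (c : ℕ → Realization K) (_ : IsBrokenLine x y n c), brokenLineLength n c

theorem euclideanGap_comm {ι : Type*} {K : AbstractSimplicialComplex ι} (x y : Realization K) :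
    euclideanGap x y = euclideanGap y x := by
  unfold euclideanGap
  rw [← neg_sub y.coord x.coord, Finsupp.sum, Finsupp.sum, Finsupp.support_neg]
  simp only [Finsupp.neg_apply, neg_sq]

theorem abs_sub_le_euclideanGap {ι : Type*} {K : AbstractSimplicialComplex ι}
    (x y : Realization K) (v : ι) : |x.coord v - y.coord v| ≤ euclideanGap x y := by
  unfold euclideanGap
  apply Real.le_sqrt_of_sq_le
  rw [sq_abs, ← Finsupp.sub_apply]
  by_cases hv : v ∈ (x.coord - y.coord).support
  · exact Finset.single_le_sum (f := fun w => ((x.coord - y.coord) w) ^ 2)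
      (fun w _ => sq_nonneg _) hv
  · rw [Finsupp.notMem_support_iff.1 hv, zero_pow two_ne_zero]
    exact Finset.sum_nonneg (s := (x.coord - y.coord).support)
      (fun w _ => sq_nonneg ((x.coord - y.coord) w))

theorem Realization.ofReal_abs_sub_le_edist {ι : Type*} {K : AbstractSimplicialComplex ι}
    (x y : Realization K) (v : ι) : ENNReal.ofReal |x.coord v - y.coord v| ≤ edist x y := by
  refine le_iInf fun n => le_iInf fun c => le_iInf fun h => ?_
  obtain ⟨rfl, rfl, -⟩ := h
  unfold brokenLineLength
  rw [← ENNReal.ofReal_sum_of_nonneg (f := fun i => euclideanGap (c i) (c (i + 1)))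
    (fun i _ => Real.sqrt_nonneg _)]
  apply ENNReal.ofReal_le_ofReal
  have key : ∀ m : ℕ, |(c 0).coord v - (c m).coord v| ≤
      ∑ i ∈ Finset.range m, euclideanGap (c i) (c (i + 1)) := by
    intro m
    induction m with
    | zero => simp
    | succ m ih =>
      rw [Finset.sum_range_succ]
      exact (abs_sub_le _ ((c m).coord v) _).trans
        (add_le_add ih (abs_sub_le_euclideanGap _ _ _))
  exact key n

theorem Realization.edist_self' {ι : Type*} {K : AbstractSimplicialComplex ι}
    (x : Realization K) : edist x x = 0 := by
  refine le_antisymm ?_ bot_le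
  refine iInf_le_of_le 0 (iInf_le_of_le (fun _ => x) (iInf_le_of_le ⟨rfl, rfl, ?_⟩ ?_))
  · intro i hi
    exact absurd hi (Nat.not_lt_zero i)
  · simp [brokenLineLength]

theorem Realization.edist_comm_le {ι : Type*} {K : AbstractSimplicialComplex ι}
    (x y : Realization K) : edist x y ≤ edist y x := by
  refine le_iInf fun n => le_iInf fun c => le_iInf fun h => ?_
  obtain ⟨h0, hn, hs⟩ := h
  refine iInf_le_of_le n (iInf_le_of_le (fun i => c (n - i)) (iInf_le_of_le ⟨?_, ?_, ?_⟩ ?_))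
  · simpa using hn
  · simpa using h0
  · intro i hi
    obtain ⟨s, hsK, h1, h2⟩ := hs (n - 1 - i) (by omega)
    refine ⟨s, hsK, ?_, ?_⟩
    · have : n - 1 - i + 1 = n - i := by omega
      simpa [this] using h2
    · have : n - 1 - i = n - (i + 1) := by omega
      simpa [this] using h1
  · unfold brokenLineLength
    rw [← Finset.sum_range_reflect]
    refine le_of_eq (Finset.sum_congr rfl fun i hi => ?_)
    have hi' := Finset.mem_range.1 hi
    have e1 : n - (n - 1 - i) = i + 1 := by omega
    have e2 : n - (n - 1 - i + 1) = i := by omega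
    simp only [e1, e2]
    rw [euclideanGap_comm]

theorem Realization.edist_triangle' {ι : Type*} {K : AbstractSimplicialComplex ι}
    (x y z : Realization K) : edist x z ≤ edist x y + edist y z := by
  have main : ∀ (n : ℕ) (c : ℕ → Realization K), IsBrokenLine x y n c →
      ∀ (m : ℕ) (d : ℕ → Realization K), IsBrokenLine y z m d →
      edist x z ≤ brokenLineLength n c + brokenLineLength m d := by
    intro n c hc m d hd
    obtain ⟨c0, cn, hc⟩ := hc
    obtain ⟨d0, dm, hd⟩ := hd
    have hle : ∀ i, i ≤ n → (if i ≤ n then c i else d (i - n)) = c i := fun i hi => if_pos hi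
    have hge : ∀ j, (if n + j ≤ n then c (n + j) else d (n + j - n)) = d j := by
      intro j
      rcases Nat.eq_zero_or_pos j with rfl | hj
      · simp [cn, d0]
      · rw [if_neg (by omega)]
        congr 1
        omega
    refine iInf_le_of_le (n + m)
      (iInf_le_of_le (fun i => if i ≤ n then c i else d (i - n)) (iInf_le_of_le ⟨?_, ?_, ?_⟩ ?_))
    · simpa using c0
    · exact (hge m).trans dm
    · intro i hi
      rcases Nat.lt_or_ge i n with h | h
      · simp only [hle i h.le, hle (i + 1) h]
        exact hc i h
      · obtain ⟨j, rfl⟩ := Nat.exists_eq_add_of_le h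
        have e := hge (j + 1)
        rw [← add_assoc] at e
        simp only [hge j, e]
        exact hd j (by omega)
    · unfold brokenLineLength
      rw [Finset.sum_range_add]
      refine add_le_add (le_of_eq (Finset.sum_congr rfl fun i hi => ?_))
        (le_of_eq (Finset.sum_congr rfl fun j _ => ?_))
      · have hi' := Finset.mem_range.1 hi
        simp only [hle i hi'.le, hle (i + 1) hi']
      · have e := hge (j + 1)
        rw [← add_assoc] at e
        simp only [hge j, e]
  change edist x z ≤ (⨅ (n : ℕ) (c : ℕ → Realization K) (_ : IsBrokenLine x y n c),
    brokenLineLength n c) + (⨅ (m : ℕ) (d : ℕ → Realization K) (_ : IsBrokenLine y z m d),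
    brokenLineLength m d)
  simp only [ENNReal.iInf_add, ENNReal.add_iInf]
  exact le_iInf fun m => le_iInf fun d => le_iInf fun hd =>
    le_iInf fun n => le_iInf fun c => le_iInf fun hc => main n c hc m d hd

/-- The realisation with its standard metric (which may take the value `∞`) and with the topology
of that metric; for locally finite complexes this is the usual weak topology. -/
instance Realization.instEMetricSpace {ι : Type*} {K : AbstractSimplicialComplex ι} :
    EMetricSpace (Realization K) where
  edist_self := Realization.edist_self'
  edist_comm x y := le_antisymm (Realization.edist_comm_le x y) (Realization.edist_comm_le y x)
  edist_triangle := Realization.edist_triangle'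
  eq_of_edist_eq_zero := by
    intro x y h
    ext v
    have h1 := Realization.ofReal_abs_sub_le_edist x y v
    rw [h, nonpos_iff_eq_zero, ENNReal.ofReal_eq_zero] at h1
    exact sub_eq_zero.1 (abs_eq_zero.1 (le_antisymm h1 (abs_nonneg _)))

open Classical in
/-- A simplicial map: it is induced by a map of vertices that sends the vertex set of each simplex
onto the vertex set of a simplex, and is affine on each simplex. -/
def IsSimplicial {ι κ : Type*} {X : AbstractSimplicialComplex ι} {Y : AbstractSimplicialComplex κ}
    (f : Realization X → Realization Y) : Prop :=
  ∃ φ : ι → κ, (∀ s ∈ X.faces, s.image φ ∈ Y.faces) ∧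
    ∀ x : Realization X, (f x).coord = Finsupp.mapDomain φ x.coord

/-- The map `f : (X, p) → (Y, q)` commutes with the control maps `p : X → M` and `q : Y → M` up to
a discrepancy less than `ε`. -/
def IsControlled {A B M : Type*} [EDist M] (ε : ℝ) (p : A → M) (q : B → M) (f : A → B) : Prop :=
  ∀ a, edist (p a) (q (f a)) < ENNReal.ofReal ε

/-- The controlled map `f : (A, p) → (B, q)` has an `ε`-controlled homotopy inverse `g`, with
`ε`-controlled homotopies `g ∘ f ∼ id` and `f ∘ g ∼ id`. A homotopy is a map from the product with
the unit interval, whose control map is the projection followed by the control map. -/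
def IsControlledHomotopyEquiv {A B M : Type*} [TopologicalSpace A] [TopologicalSpace B] [EDist M]
    (ε : ℝ) (p : A → M) (q : B → M) (f : C(A, B)) : Prop :=
  (∀ a, p a = q (f a)) ∧
  ∃ g : C(B, A), IsControlled ε q p g ∧
    (∃ h : (g.comp f).Homotopy (ContinuousMap.id A),
      IsControlled ε (fun z : I × A => p z.2) p h) ∧
    (∃ h : (f.comp g).Homotopy (ContinuousMap.id B),
      IsControlled ε (fun z : I × B => q z.2) q h)

/-- The map `f : (A, p) → (B, q)` of spaces with control maps to the simplicial complex `Z` is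
`Z`-triangular: `q (f (p⁻¹ (open simplex)))` lies in the closed simplex. -/
def IsTriangular {A B κ : Type*} {Z : AbstractSimplicialComplex κ}
    (p : A → Realization Z) (q : B → Realization Z) (f : A → B) : Prop :=
  ∀ s ∈ Z.faces, q '' (f '' (p ⁻¹' openSimplex Z s)) ⊆ closedSimplex Z s

/-- `f : (A, p) → (B, q)` is a `Z`-triangular homotopy equivalence: `f`, some homotopy inverse and
both homotopies are `Z`-triangular. -/
def IsTriangularHomotopyEquiv {A B κ : Type*} [TopologicalSpace A] [TopologicalSpace B]
    {Z : AbstractSimplicialComplex κ} (p : A → Realization Z) (q : B → Realization Z)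
    (f : C(A, B)) : Prop :=
  IsTriangular p q f ∧
  ∃ g : C(B, A), IsTriangular q p g ∧
    (∃ h : (f.comp g).Homotopy (ContinuousMap.id B),
      IsTriangular (fun z : I × B => q z.2) q h) ∧
    (∃ h : (g.comp f).Homotopy (ContinuousMap.id A),
      IsTriangular (fun z : I × A => p z.2) p h)

end

/-!
Squeezing a controlled homotopy equivalence. Fix `δ > 0` so small that every point of `Y` has a
barycentric coordinate exceeding `δ`. Multiplying the coordinates of a point of `Y` by
`max (y_w - δ) 0` and normalising gives a map `r : Y → Y`, which lifts along the simplicial map `f`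
to `r' : X → X` with `f ∘ r' = r ∘ f`. Both are homotopic to the identity by straight lines inside
simplices, and `r` moves every point within `δ` of the open simplex `s` into the closed simplex `s`.
If `g` is a `δ`-controlled homotopy inverse of `f`, then `r' ∘ g` is a triangular one. As the squeezing is applied to the inverse and the homotopies,
`f` itself need not be deformed.
-/

namespace Realization

variable {ι κ : Type*} {K : AbstractSimplicialComplex ι} {L : AbstractSimplicialComplex κ}

/-! The carrier of a point is the support of its coordinates, and a map is triangular exactly when
carriers never grow (`isTriangular_iff`). Each coordinate is 1-Lipschitz for the path metric, so if
`y'` is within `δ` of `y`, every vertex where `y'` exceeds `δ` belongs to the carrier of `y`.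
Discarding the coordinates up to `δ` thus turns `δ`-closeness into containment of carriers. The lift
`r'` exists because the weights on the vertices of `Y` pull back along the vertex map of `f`
(`coord_reweight_eq_mapDomain`).

The controlled homotopies `f ∘ g ∼ id` and `g ∘ f ∼ id` become triangular after composition with `r`
and `r'`. They then end at `r` and `r'`, which straight lines inside carriers join to the
identities. All continuity is checked on coordinates (`continuous_of_coord`). -/

theorem sum_coord_eq_one (x : Realization K) {s : Finset ι} (hs : x.coord.support ⊆ s) :
    ∑ v ∈ s, x.coord v = 1 := by
  rw [← x.sum_eq_one, Finsupp.sum_of_support_subset _ hs _ (fun _ _ => rfl)]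

theorem mem_support_iff_pos (x : Realization K) {v : ι} :
    v ∈ x.coord.support ↔ 0 < x.coord v := by
  rw [Finsupp.mem_support_iff, (x.nonneg v).lt_iff_ne']

/-- The point of the carrier of `x` with barycentric coordinates `c`. -/
noncomputable def ofCarrier (x : Realization K) (c : ι → ℝ) (hc : ∀ v, 0 ≤ c v)
    (hsupp : ∀ v, c v ≠ 0 → v ∈ x.coord.support) (hsum : ∑ v ∈ x.coord.support, c v = 1) :
    Realization K where
  coord := Finsupp.onFinset x.coord.support c hsupp
  nonneg := hc
  sum_eq_one := by
    rw [Finsupp.onFinset_sum _ (fun _ => rfl)]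
    exact hsum
  support_mem := by
    refine K.isRelLowerSet_faces.mem_of_le x.support_mem Finsupp.support_onFinset_subset ?_
    -- Faces are closed under nonempty subsets only; an empty support would contradict total mass
    -- one.
    by_contra h
    rw [Finset.not_nonempty_iff_eq_empty, Finsupp.support_eq_empty] at h
    have h0 : ∀ v, c v = 0 := fun v => DFunLike.congr_fun h v
    simp [h0] at hsum

theorem support_ofCarrier_subset (x : Realization K) (c : ι → ℝ) (hc : ∀ v, 0 ≤ c v)
    (hsupp : ∀ v, c v ≠ 0 → v ∈ x.coord.support) (hsum : ∑ v ∈ x.coord.support, c v = 1) :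
    (x.ofCarrier c hc hsupp hsum).coord.support ⊆ x.coord.support :=
  fun v hv => hsupp v (Finsupp.mem_support_iff.1 hv)

/-! ### The metric topology in barycentric coordinates -/

theorem edist_le_euclideanGap {x y : Realization K}
    (h : x.coord.support ⊆ y.coord.support) :
    edist x y ≤ ENNReal.ofReal (euclideanGap x y) := by
  refine iInf_le_of_le 1 (iInf_le_of_le (fun i => if i = 0 then x else y)
    (iInf_le_of_le ⟨by simp, by simp, ?_⟩ ?_))
  · intro i hi
    obtain rfl : i = 0 := by omega
    exact ⟨y.coord.support, y.support_mem, by simpa [closedSimplex] using h,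
      by simp [closedSimplex]⟩
  · simp [brokenLineLength]

/-- The mass of `y` outside the carrier of `x` equals the mass lost on that carrier. The bound
therefore involves only a set of vertices that stays fixed while `y` varies. -/
theorem euclideanGap_le_sum {x y : Realization K} (h : x.coord.support ⊆ y.coord.support) :
    euclideanGap x y ≤ 2 * ∑ v ∈ x.coord.support, |x.coord v - y.coord v| := by
  classical
  have hsub : (x.coord - y.coord).support ⊆ y.coord.support :=
    Finsupp.support_sub.trans (Finset.union_subset h le_rfl)
  have h1 : euclideanGap x y ≤ ∑ v ∈ y.coord.support, |x.coord v - y.coord v| := by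
    unfold euclideanGap
    rw [Finsupp.sum_of_support_subset _ hsub _ (by simp)]
    refine Real.sqrt_le_iff.2 ⟨Finset.sum_nonneg fun _ _ => abs_nonneg _, ?_⟩
    simp only [Finsupp.sub_apply]
    calc ∑ v ∈ y.coord.support, (x.coord v - y.coord v) ^ 2
        = ∑ v ∈ y.coord.support, |x.coord v - y.coord v| ^ 2 := by simp only [sq_abs]
      _ ≤ _ := Finset.sum_sq_le_sq_sum_of_nonneg fun _ _ => abs_nonneg _
  have h2 : ∑ v ∈ y.coord.support \ x.coord.support, |x.coord v - y.coord v| ≤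
      ∑ v ∈ x.coord.support, |x.coord v - y.coord v| := by
    have e : ∑ v ∈ y.coord.support \ x.coord.support, |x.coord v - y.coord v| =
        ∑ v ∈ y.coord.support \ x.coord.support, y.coord v :=
      Finset.sum_congr rfl fun v hv => by
        rw [Finsupp.notMem_support_iff.1 (Finset.mem_sdiff.1 hv).2, zero_sub, abs_neg,
          abs_of_nonneg (y.nonneg v)]
    have hy := y.sum_coord_eq_one subset_rfl
    rw [← Finset.sum_sdiff h] at hy
    have hx := x.sum_coord_eq_one subset_rfl
    calc _ = ∑ v ∈ x.coord.support, (x.coord v - y.coord v) := by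
          rw [e, Finset.sum_sub_distrib]; linarith
      _ ≤ _ := Finset.sum_le_sum fun _ _ => le_abs_self _
  have h3 := Finset.sum_sdiff (f := fun v => |x.coord v - y.coord v|) h
  linarith

theorem continuous_coord (v : ι) : Continuous fun x : Realization K => x.coord v := by
  rw [continuous_iff_continuousAt]
  intro x
  rw [ContinuousAt, EMetric.tendsto_nhds]
  intro e he
  filter_upwards [Metric.eball_mem_nhds x he] with y hy
  rw [edist_dist, Real.dist_eq]
  exact (ofReal_abs_sub_le_edist y x v).trans_lt hy

/-- Finitely many coordinates are positive at `t₀`, and positivity is an open condition: open stars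
are open. -/
theorem eventually_support_subset {T : Type*} [TopologicalSpace T] {F : T → Realization K}
    (hF : ∀ v, Continuous fun t => (F t).coord v) (t₀ : T) :
    ∀ᶠ t in nhds t₀, (F t₀).coord.support ⊆ (F t).coord.support := by
  have h : ∀ᶠ t in nhds t₀, ∀ v ∈ (F t₀).coord.support, 0 < (F t).coord v :=
    (Filter.eventually_all_finset _).2 fun v hv =>
      (hF v).continuousAt.eventually_const_lt ((F t₀).mem_support_iff_pos.1 hv)
  exact h.mono fun t ht v hv => (F t).mem_support_iff_pos.2 (ht v hv)

/-- The topology of the path metric is the coarsest for which the barycentric coordinates are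
continuous. -/
theorem continuous_of_coord {T : Type*} [TopologicalSpace T] {F : T → Realization K}
    (hF : ∀ v, Continuous fun t => (F t).coord v) : Continuous F := by
  rw [continuous_iff_continuousAt]
  intro t₀
  -- The sum runs over the fixed finite carrier of `F t₀`, so it is continuous without local
  -- finiteness.
  have hlim : Filter.Tendsto (fun t => ENNReal.ofReal
      (2 * ∑ v ∈ (F t₀).coord.support, |(F t₀).coord v - (F t).coord v|)) (nhds t₀) (nhds 0) := by
    have hc : Continuous fun t => ENNReal.ofReal
        (2 * ∑ v ∈ (F t₀).coord.support, |(F t₀).coord v - (F t).coord v|) :=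
      ENNReal.continuous_ofReal.comp (continuous_const.mul
        (continuous_finsetSum _ fun v _ => (continuous_const.sub (hF v)).abs))
    simpa using hc.tendsto t₀
  rw [ContinuousAt, EMetric.tendsto_nhds]
  intro e he
  filter_upwards [eventually_support_subset hF t₀, hlim.eventually_lt_const he] with t ht hlt
  rw [edist_comm]
  exact ((edist_le_euclideanGap ht).trans
    (ENNReal.ofReal_le_ofReal (euclideanGap_le_sum ht))).trans_lt hlt

/-- In a locally finite complex, nearby points lie in finitely many simplices. -/
theorem exists_finset_support_subset (hK : LocallyFiniteComplex K) (x₀ : Realization K) :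
    ∃ s : Finset ι, ∀ᶠ x : Realization K in nhds x₀, x.coord.support ⊆ s := by
  classical
  -- Points near `x₀` have the vertex `v` of its carrier in theirs, and the simplices containing `v`
  -- have finitely many vertices altogether.
  obtain ⟨v, hv⟩ := K.isRelLowerSet_faces.prop_of_mem x₀.support_mem
  refine ⟨(hK v).toFinset.biUnion id, ?_⟩
  filter_upwards [eventually_support_subset (F := id) continuous_coord x₀] with x hx w hw
  exact Finset.mem_biUnion.2
    ⟨x.coord.support, (hK v).mem_toFinset.2 ⟨x.support_mem, hx hv⟩, hw⟩

/-- The index set jumps with `x`, but near each point it may be replaced by one finite set, since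
the added terms vanish. -/
theorem continuous_sum_coord_mul (hK : LocallyFiniteComplex K) (a : ι → C(Realization K, ℝ)) :
    Continuous fun x : Realization K => ∑ v ∈ x.coord.support, x.coord v * a v x := by
  rw [continuous_iff_continuousAt]
  intro x₀
  obtain ⟨s, hs⟩ := exists_finset_support_subset hK x₀
  have hc : Continuous fun x : Realization K => ∑ v ∈ s, x.coord v * a v x :=
    continuous_finsetSum _ fun v _ => (continuous_coord v).mul (a v).continuous
  refine hc.continuousAt.congr (hs.mono fun x hx => ?_)
  refine (Finset.sum_subset hx fun v _ hv => ?_).symm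
  rw [Finsupp.notMem_support_iff.1 hv, zero_mul]

/-! ### Reweighting and straight-line homotopies -/

/-- Multiply the barycentric coordinates of `x` by the weights `a` and normalise. -/
noncomputable def reweight (x : Realization K) (a : ι → ℝ) (ha : ∀ v, 0 ≤ a v)
    (hpos : 0 < ∑ v ∈ x.coord.support, x.coord v * a v) : Realization K :=
  x.ofCarrier (fun v => x.coord v * a v / ∑ v ∈ x.coord.support, x.coord v * a v)
    (fun v => div_nonneg (mul_nonneg (x.nonneg v) (ha v)) hpos.le)
    (fun v hv => Finsupp.mem_support_iff.2 fun h => hv (by simp [h]))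
    (by rw [← Finset.sum_div, div_self hpos.ne'])

theorem reweight_coord (x : Realization K) (a : ι → ℝ) (ha : ∀ v, 0 ≤ a v)
    (hpos : 0 < ∑ v ∈ x.coord.support, x.coord v * a v) (v : ι) :
    (x.reweight a ha hpos).coord v =
      x.coord v * a v / ∑ v ∈ x.coord.support, x.coord v * a v := rfl

theorem ne_zero_of_mem_support_reweight {x : Realization K} {a : ι → ℝ} {ha : ∀ v, 0 ≤ a v}
    {hpos : 0 < ∑ v ∈ x.coord.support, x.coord v * a v} {v : ι}
    (hv : v ∈ (x.reweight a ha hpos).coord.support) : a v ≠ 0 := by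
  rintro h
  rw [Finsupp.mem_support_iff, reweight_coord, h] at hv
  simp at hv

theorem support_reweight_subset (x : Realization K) (a : ι → ℝ) (ha : ∀ v, 0 ≤ a v)
    (hpos : 0 < ∑ v ∈ x.coord.support, x.coord v * a v) :
    (x.reweight a ha hpos).coord.support ⊆ x.coord.support :=
  support_ofCarrier_subset x _ _ _ _

/-- The reweighting of all points by continuous weights. -/
noncomputable def reweightMap (hK : LocallyFiniteComplex K) (a : ι → C(Realization K, ℝ))
    (ha : ∀ v x, 0 ≤ a v x)
    (hpos : ∀ x : Realization K, 0 < ∑ v ∈ x.coord.support, x.coord v * a v x) :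
    C(Realization K, Realization K) where
  toFun x := x.reweight (fun v => a v x) (fun v => ha v x) (hpos x)
  continuous_toFun := continuous_of_coord fun v =>
    ((continuous_coord v).mul (a v).continuous).div (continuous_sum_coord_mul hK a)
      fun x => (hpos x).ne'

theorem support_reweightMap_subset (hK : LocallyFiniteComplex K) (a : ι → C(Realization K, ℝ))
    (ha : ∀ v x, 0 ≤ a v x)
    (hpos : ∀ x : Realization K, 0 < ∑ v ∈ x.coord.support, x.coord v * a v x)
    (x : Realization K) : (reweightMap hK a ha hpos x).coord.support ⊆ x.coord.support :=
  support_reweight_subset x (fun v => a v x) (fun v => ha v x) (hpos x)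

/-- The point dividing the straight segment from `x'` to `x` in the ratio `t : 1 - t`. -/
noncomputable def segment (x' x : Realization K) (h : x'.coord.support ⊆ x.coord.support) (t : I) :
    Realization K :=
  x.ofCarrier (fun v => (1 - t) * x'.coord v + t * x.coord v)
    (fun v => add_nonneg (mul_nonneg (sub_nonneg.2 t.2.2) (x'.nonneg v))
      (mul_nonneg t.2.1 (x.nonneg v)))
    (fun v hv => by
      by_contra hx
      apply hv
      rw [Finsupp.notMem_support_iff.1 hx, Finsupp.notMem_support_iff.1 fun hx' => hx (h hx')]
      simp)
    (by
      rw [Finset.sum_add_distrib, ← Finset.mul_sum, ← Finset.mul_sum,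
        x.sum_coord_eq_one subset_rfl, x'.sum_coord_eq_one h]
      ring)

theorem support_segment_subset (x' x : Realization K)
    (h : x'.coord.support ⊆ x.coord.support) (t : I) :
    (segment x' x h t).coord.support ⊆ x.coord.support :=
  support_ofCarrier_subset x _ _ _ _

/-- The straight line homotopy to the identity from a map that does not enlarge carriers. -/
noncomputable def straightLineHomotopy (r : C(Realization K, Realization K))
    (hr : ∀ x, (r x).coord.support ⊆ x.coord.support) :
    r.Homotopy (ContinuousMap.id (Realization K)) where
  toFun z := segment (r z.2) z.2 (hr z.2) z.1
  continuous_toFun := continuous_of_coord fun v => by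
    have h1 : Continuous fun z : I × Realization K => (r z.2).coord v :=
      (continuous_coord v).comp (r.continuous.comp continuous_snd)
    have h2 : Continuous fun z : I × Realization K => z.2.coord v :=
      (continuous_coord v).comp continuous_snd
    have h3 : Continuous fun z : I × Realization K => (z.1 : ℝ) :=
      continuous_subtype_val.comp continuous_fst
    exact ((continuous_const.sub h3).mul h1).add (h3.mul h2)
  map_zero_left x := by
    ext v
    change (1 - (0 : ℝ)) * (r x).coord v + 0 * x.coord v = _
    ring
  map_one_left x := by
    ext v
    change (1 - (1 : ℝ)) * (r x).coord v + 1 * x.coord v = x.coord v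
    ring

/-! ### Compatibility with simplicial maps -/

theorem mapDomain_apply_eq_sum (φ : ι → κ) [DecidableEq κ] (c : ι →₀ ℝ) {s : Finset ι}
    (hs : c.support ⊆ s) (w : κ) :
    Finsupp.mapDomain φ c w = ∑ v ∈ s, if φ v = w then c v else 0 := by
  rw [Finsupp.mapDomain, Finsupp.sum_apply, Finsupp.sum_of_support_subset _ hs _ (by simp)]
  simp only [Finsupp.single_apply]

/-- This identifies the normalising denominators upstairs and downstairs. -/
theorem sum_mapDomain_mul {x : Realization K} {y : Realization L} {φ : ι → κ}
    (h : y.coord = Finsupp.mapDomain φ x.coord) (b : κ → ℝ) :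
    ∑ w ∈ y.coord.support, y.coord w * b w =
      ∑ v ∈ x.coord.support, x.coord v * b (φ v) := by
  change y.coord.sum (fun w t => t * b w) = x.coord.sum fun v t => t * b (φ v)
  rw [h, Finsupp.sum_mapDomain_index (by simp) (by intros; ring)]

/-- Simplicial maps commute with reweighting, if the weights correspond. -/
theorem coord_reweight_eq_mapDomain {x : Realization K} {y : Realization L} {φ : ι → κ}
    (h : y.coord = Finsupp.mapDomain φ x.coord) {b : κ → ℝ} (hb : ∀ w, 0 ≤ b w)
    (hx : 0 < ∑ v ∈ x.coord.support, x.coord v * b (φ v))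
    (hy : 0 < ∑ w ∈ y.coord.support, y.coord w * b w) :
    (y.reweight b hb hy).coord =
      Finsupp.mapDomain φ (x.reweight (fun v => b (φ v)) (fun v => hb (φ v)) hx).coord := by
  classical
  ext w
  rw [reweight_coord, mapDomain_apply_eq_sum φ _ (x.support_reweight_subset _ _ _),
    sum_mapDomain_mul h, h, mapDomain_apply_eq_sum φ _ subset_rfl, Finset.sum_mul,
    Finset.sum_div]
  refine Finset.sum_congr rfl fun v _ => ?_
  rw [reweight_coord]
  split_ifs with hv
  · rw [hv]
  · simp

/-- Coordinates are non-negative, so nothing cancels when they are added over the fibres of `φ`. -/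
theorem support_mapDomain_mono {x x' : Realization K} {y y' : Realization L} {φ : ι → κ}
    (h : y.coord = Finsupp.mapDomain φ x.coord) (h' : y'.coord = Finsupp.mapDomain φ x'.coord)
    (hsub : x'.coord.support ⊆ x.coord.support) : y'.coord.support ⊆ y.coord.support := by
  classical
  intro w hw
  rw [h'] at hw
  obtain ⟨v, hv, rfl⟩ := Finset.mem_image.1 (Finsupp.mapDomain_support hw)
  rw [mem_support_iff_pos, h, mapDomain_apply_eq_sum φ _ subset_rfl]
  have hv' := hsub hv
  refine (x.mem_support_iff_pos.1 hv').trans_le ?_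
  have := Finset.single_le_sum (f := fun u => if φ u = φ v then x.coord u else 0)
    (fun u _ => by
      split_ifs
      exacts [x.nonneg u, le_rfl]) hv'
  simpa using this

/-! ### The squeezing weights -/

theorem exists_lt_coord {n : ℕ} (hn : ∀ s ∈ K.faces, s.card ≤ n + 1) (x : Realization K) :
    ∃ v ∈ x.coord.support, 1 / ((n : ℝ) + 2) < x.coord v := by
  by_contra! h
  -- At most `n + 1` coordinates sum to one; the bound `1 / (n + 2)` instead of `1 / (n + 1)` makes
  -- the inequality strict.
  have h1 := Finset.sum_le_sum h
  rw [x.sum_coord_eq_one subset_rfl, Finset.sum_const, nsmul_eq_mul, mul_one_div,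
    le_div_iff₀ (by positivity), one_mul] at h1
  have h2 : (x.coord.support.card : ℝ) ≤ n + 1 := by exact_mod_cast hn _ x.support_mem
  linarith

/-- The amount by which the coordinate at `v` exceeds `δ`. -/
noncomputable def excess (K : AbstractSimplicialComplex ι) (δ : ℝ) (v : ι) : C(Realization K, ℝ) where
  toFun x := max (x.coord v - δ) 0
  continuous_toFun := ((continuous_coord v).sub continuous_const).max continuous_const

theorem excess_apply (δ : ℝ) (v : ι) (x : Realization K) :
    excess K δ v x = max (x.coord v - δ) 0 := rfl

/-- The denominator never vanishes, so reweighting by the excess is defined everywhere. -/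
theorem sum_coord_mul_excess_pos {n : ℕ} (hn : ∀ s ∈ K.faces, s.card ≤ n + 1)
    (x : Realization K) :
    0 < ∑ v ∈ x.coord.support, x.coord v * excess K (1 / ((n : ℝ) + 2)) v x := by
  obtain ⟨v, hv, hlt⟩ := exists_lt_coord hn x
  refine Finset.sum_pos' (fun w _ => mul_nonneg (x.nonneg w) (le_max_right _ _))
    ⟨v, hv, mul_pos (x.mem_support_iff_pos.1 hv) (lt_max_of_lt_left (sub_pos.2 hlt))⟩

/-- If `x'` is within `δ` of `x`, then the vertices at which `x'` exceeds `δ` carry `x`. -/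
theorem mem_support_of_excess_ne_zero {δ : ℝ} {x x' : Realization K}
    (h : edist x x' < ENNReal.ofReal δ) {v : ι} (hv : excess K δ v x' ≠ 0) :
    v ∈ x.coord.support := by
  have h1 : |x.coord v - x'.coord v| < δ :=
    (ENNReal.ofReal_lt_ofReal_iff_of_nonneg (abs_nonneg _)).1
      ((ofReal_abs_sub_le_edist x x' v).trans_lt h)
  have h2 : 0 < x'.coord v - δ := by
    by_contra! hle
    exact hv (max_eq_right hle)
  rw [mem_support_iff_pos]
  linarith [(abs_lt.1 h1).1]

end Realization

/-! ### Triangular maps and the squeezing argument -/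

theorem isTriangular_iff {A B κ : Type*} {Z : AbstractSimplicialComplex κ}
    {p : A → Realization Z} {q : B → Realization Z} {f : A → B} :
    IsTriangular p q f ↔ ∀ a, (q (f a)).coord.support ⊆ (p a).coord.support := by
  constructor
  · intro h a
    -- Every point lies in the open simplex of its own carrier.
    exact h _ (p a).support_mem ⟨f a, ⟨a, rfl, rfl⟩, rfl⟩
  · rintro h s - _ ⟨_, ⟨a, rfl, rfl⟩, rfl⟩
    exact h a

theorem IsTriangular.homotopy_trans {A B κ : Type*} [TopologicalSpace A] [TopologicalSpace B]
    {Z : AbstractSimplicialComplex κ} {p : A → Realization Z} {q : B → Realization Z}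
    {f₀ f₁ f₂ : C(A, B)} {F : f₀.Homotopy f₁} {G : f₁.Homotopy f₂}
    (hF : IsTriangular (fun z : I × A => p z.2) q F)
    (hG : IsTriangular (fun z : I × A => p z.2) q G) :
    IsTriangular (fun z : I × A => p z.2) q (F.trans G) := by
  rw [isTriangular_iff] at *
  intro z
  rw [ContinuousMap.Homotopy.trans_apply]
  split_ifs
  · exact hF _
  · exact hG _

open Realization in
/-- A map of `Y` that does not enlarge carriers and moves points near an open simplex into the
closed simplex, together with a lift along the simplicial map `f`. -/
theorem exists_squeezing {ι κ : Type*} {X : AbstractSimplicialComplex ι}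
    {Y : AbstractSimplicialComplex κ} (hX : LocallyFiniteComplex X) (hY : LocallyFiniteComplex Y)
    {n : ℕ} (hn : ∀ s ∈ Y.faces, s.card ≤ n + 1) {f : C(Realization X, Realization Y)}
    {φ : ι → κ} (hφ : ∀ x, (f x).coord = Finsupp.mapDomain φ x.coord) :
    ∃ (r : C(Realization Y, Realization Y)) (r' : C(Realization X, Realization X)),
      (∀ y, (r y).coord.support ⊆ y.coord.support) ∧
      (∀ x, (r' x).coord.support ⊆ x.coord.support) ∧
      (∀ x, f (r' x) = r (f x)) ∧
      ∀ y y' : Realization Y, edist y y' < ENNReal.ofReal (1 / ((n : ℝ) + 2)) →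
        (r y').coord.support ⊆ y.coord.support := by
  have hnonneg : ∀ w (y : Realization Y), 0 ≤ excess Y (1 / ((n : ℝ) + 2)) w y :=
    fun w y => le_max_right _ _
  have hpos := sum_coord_mul_excess_pos hn
  have hpos' : ∀ x : Realization X, 0 < ∑ v ∈ x.coord.support,
      x.coord v * (excess Y (1 / ((n : ℝ) + 2)) (φ v)).comp f x :=
    fun x => (hpos (f x)).trans_eq
      (sum_mapDomain_mul (hφ x) fun w => excess Y (1 / ((n : ℝ) + 2)) w (f x))
  refine ⟨reweightMap hY (excess Y _) hnonneg hpos,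
    reweightMap hX (fun v => (excess Y (1 / ((n : ℝ) + 2)) (φ v)).comp f)
      (fun v x => hnonneg (φ v) (f x)) hpos',
    support_reweightMap_subset _ _ _ _, support_reweightMap_subset _ _ _ _, fun x => ?_, ?_⟩
  · refine Realization.ext ((hφ _).trans ?_)
    exact (coord_reweight_eq_mapDomain (hφ x)
      (b := fun w => excess Y (1 / ((n : ℝ) + 2)) w (f x)) (fun w => hnonneg w (f x))
      (hpos' x) (hpos (f x))).symm
  · intro y y' hd w hw
    exact mem_support_of_excess_ne_zero hd (ne_zero_of_mem_support_reweight
      (a := fun w => excess Y (1 / ((n : ℝ) + 2)) w y') (ha := fun w => hnonneg w y')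
      (hpos := hpos y') hw)

open Realization in
/-- A simplicial map which is a controlled homotopy equivalence, with control so fine that every
point of the target has a larger barycentric coordinate, is a triangular homotopy equivalence. -/
theorem isTriangularHomotopyEquiv_of_isControlled {ι κ : Type*} {X : AbstractSimplicialComplex ι}
    {Y : AbstractSimplicialComplex κ} (hX : LocallyFiniteComplex X) (hY : LocallyFiniteComplex Y)
    {n : ℕ} (hn : ∀ s ∈ Y.faces, s.card ≤ n + 1) {f : C(Realization X, Realization Y)}
    (hf : IsSimplicial f)
    (hequiv : IsControlledHomotopyEquiv (1 / ((n : ℝ) + 2)) f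
      (id : Realization Y → Realization Y) f) :
    IsTriangularHomotopyEquiv f (id : Realization Y → Realization Y) f := by
  obtain ⟨φ, -, hφ⟩ := hf
  obtain ⟨-, g, hg, ⟨h, hh⟩, ⟨k, hk⟩⟩ := hequiv
  obtain ⟨r, r', hr, hr', hfr, hclose⟩ := exists_squeezing hX hY hn hφ
  have hrk : r.comp (f.comp g) = f.comp (r'.comp g) :=
    ContinuousMap.ext fun y => (hfr (g y)).symm
  -- The inverse is `r' ∘ g`. The homotopies are `f ∘ r' ∘ g = r ∘ f ∘ g ∼ r ∼ id` and `r' ∘ g ∘ f ∼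
  -- r' ∼ id`, each the squeezed controlled homotopy followed by a straight line.
  refine ⟨isTriangular_iff.2 fun x => subset_rfl, r'.comp g, isTriangular_iff.2 fun y => ?_,
    ⟨(((ContinuousMap.Homotopy.refl r).comp k).cast hrk r.comp_id).trans
      (straightLineHomotopy r hr), .homotopy_trans (isTriangular_iff.2 fun z => ?_)
      (isTriangular_iff.2 fun z => ?_)⟩,
    ⟨(((ContinuousMap.Homotopy.refl r').comp h).cast rfl r'.comp_id).trans
      (straightLineHomotopy r' hr'), .homotopy_trans (isTriangular_iff.2 fun z => ?_)
      (isTriangular_iff.2 fun z => ?_)⟩⟩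
  · change (f (r' (g y))).coord.support ⊆ y.coord.support
    rw [hfr]
    exact hclose _ _ (hg y)
  · exact hclose _ _ (hk z)
  · exact support_segment_subset _ _ (hr z.2) z.1
  · change (f (r' (h z))).coord.support ⊆ (f z.2).coord.support
    rw [hfr]
    exact hclose _ _ (hh z)
  -- The line from `r' x` to `x` stays in the carrier of `x`, so its image under `f` stays in the
  -- carrier of `f x`.
  · exact support_mapDomain_mono (hφ _) (hφ _) (support_segment_subset _ _ (hr' z.2) z.1)

theorem theorem6p9 {ι κ : Type*} (X : AbstractSimplicialComplex ι) (Y : AbstractSimplicialComplex κ)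
    (hXdim : FiniteDimensionalComplex X) (hYdim : FiniteDimensionalComplex Y)
    (hXfin : LocallyFiniteComplex X) (hYfin : LocallyFiniteComplex Y) :
    ∃ ε : ℝ, 0 < ε ∧ ∀ f : C(Realization X, Realization Y), IsSimplicial f →
      IsControlledHomotopyEquiv ε f (id : Realization Y → Realization Y) f →
      ∃ f' : C(Realization X, Realization Y), f.Homotopic f' ∧
        IsTriangularHomotopyEquiv f (id : Realization Y → Realization Y) f' ∧
        IsTriangularHomotopyEquiv f' (id : Realization Y → Realization Y) f' := by
  obtain ⟨n, hn⟩ := hYdim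
  refine ⟨1 / ((n : ℝ) + 2), by positivity, fun f hf hequiv => ?_⟩
  have hT := isTriangularHomotopyEquiv_of_isControlled hXfin hYfin hn hf hequiv
  exact ⟨f, ContinuousMap.Homotopic.refl f, hT, hT⟩
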